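/- **Setting.** Let $\mathcal I$ be the iterated logarithmic algebra: formal sums with complex coefficients of monomials $x^a\ell^\beta$, where $\ell^\beta=(\log x)^{\beta_1}(\log\log x)^{\beta_2}\cdots$, $a\in\mathbb R$ and $\beta$ is a finitely supported real vector, whose support is Noetherian (every nonempty subset has a largest element) for the lexicographic order of $(a,\beta_1,\beta_2,\dots)$; let $D=d/dx$. Let $\lfloor a\rceil!=\Gamma(a+1)$ if $a$ is not a negative integer, $\lfloor a\rceil!=(-1)^{a+1}/(-a-1)!$ if it is, and let $\lfloor a\rceil=a$ for $a\ne0$, $\lfloor 0\rceil=1$. The harmonic logarithm of degree $a\in\mathbb R$ and order $\alpha$ is $$\lambda_a^\alpha(x)=\lfloor a\rceil!\,x^a\sum_{k\ge0}s(-a,k)\,\Bigl(x\frac{d}{dx}\Bigr)^k\ell^\alpha,\qquad \sum_k s(-a,k)y^k=\frac{\Gamma(1+y)}{\Gamma(1+a+y)};$$ thus $\lambda_0^\alpha=\ell^\alpha$ and $\lambda_{-1}^{(1)}(x)=x^{-1}$, where $(1)=(1,0,0,\dots)$. A series of order $\alpha$ is a sum $\sum_b c_b\lambda_b^\alpha(x)$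 whose support $\{b : c_b\neq 0\}$ is Noetherian; $\langle p\rangle_\alpha$ denotes the coefficient of $\lambda_0^\alpha$ in $p$. For $\alpha\neq(0)$, an Artinian operator $\sum_b g_bD^b$ (real exponents, well-ordered support) acts on the series of order $\alpha$ by $D^b\lambda_a^\alpha=\frac{\lfloor a\rceil!}{\lfloor a-b\rceil!}\lambda_{a-b}^\alpha$. A differential operator of degree one is a formal power series $f(D)=\sum_{k\ge1}c_kD^k$ with $c=c_1\ne0$; its Pincherle derivative is $f'(D)=\sum_{k\ge 1}kc_kD^{k-1}$. For $n\in\mathbb Z$ and $b\in\mathbb R$ put $f(D)^{b;n}=e^{b(\log c+2\pi i n)}D^b\bigl(f(D)/(cD)\bigr)^b$ and $\bigl(D/f(D)\bigr)^{b;n}=D^b f(D)^{-b;n}=e^{-b(\log c+2\pi i n)}\bigl(cD/f(D)\bigr)^b$, where real powers of a power series with constant term $1$ are given by the binomial series. Let $S$ be a set of orders containing $(1)$ (for instance all finitely supported integer vectors, or all finitely supported real vectors). A family $p_a^\alpha(x)$, with $\alpha\in S$ and with $a\in\mathbb Z$ (discrete case) or $a\in\mathbb R$ (continuous case), is a *graded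 sequence* if $p_a^\alpha=\sum_{b\le a}c_{ab}\lambda_b^\alpha$ is a series of order $\alpha$ with $c_{aa}\neq0$ and with coefficients $c_{ab}$ independent of $\alpha$; in the discrete case only integers $b$ occur. It is the *associated* (in the continuous case, the *$n$-th associated*) graded sequence of $f(D)$ if moreover $\langle p_0^\alpha\rangle_\alpha=1$, $\langle p_a^\alpha\rangle_\alpha=0$ for $a\ne0$, and, for all $\alpha\neq(0)$, $$f(D)p_a^\alpha=\lfloor a\rceil\,p_{a-1}^\alpha\ \text{(discrete)},\qquad f(D)^{b;n}p_a^\alpha=\frac{\lfloor a\rceil!}{\lfloor a-b\rceil!}\,p_{a-b}^\alpha\ \text{ for all } a,b\in\mathbb R\ \text{(continuous)}.$$ **Theorem (Transfer Formula).** Let $f(D)$ be a differential operator of degree one. 1. (Discrete) If $p_a^\alpha$ is its associated graded sequence, then $p_a^\alpha(x)=f'(D)\left(\frac{D}{f(D)}\right)^{a+1}\lambda_a^\alpha(x)$ for all $a\in\mathbb Z$ and all $\alpha\in S$ (including $\alpha=(0)$ if it belongs to $S$). 2. (Continuous) If $p_a^\alpha$ is its $n$-th associated graded sequence, then $p_a^\alpha(x)=f'(D)\left(\frac{D}{f(D)}\right)^{a+1;n}\lambda_a^\alpha(x)$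 for all $a\in\mathbb R$ and all $\alpha\in S$ (including $\alpha=(0)$ if it belongs to $S$). In particular, in both cases the residual series is $p_{-1}^{(1)}(x)=f'(D)\,x^{-1}$. -/

import Mathlib

namespace IterLog

open scoped Pointwise

noncomputable section

/-! ### The iterated logarithmic algebra -/

/-- Exponents of monomials `x ^ a * ∏ j, ℓ_j ^ (β j)`, where `ℓ_0 = log x`, `ℓ_1 = log log x`, ….
They are compared by growth at infinity, that is lexicographically; the order is then reversed,
so that well-ordered supports (Hahn series) are the Noetherian supports. -/
abbrev Expo : Type := (ℝ ×ₗ Lex (ℕ →₀ ℝ))ᵒᵈ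

/-- The exponent of the monomial `x ^ a * ∏ j, ℓ_j ^ (β j)`. -/
def expo (a : ℝ) (β : ℕ →₀ ℝ) : Expo := OrderDual.toDual (toLex (a, toLex β))

/-- The exponent of `x`. -/
def xExp (g : Expo) : ℝ := (ofLex (OrderDual.ofDual g)).1

/-- The exponents of the iterated logarithms. -/
def logExp (g : Expo) : ℕ →₀ ℝ := ofLex (ofLex (OrderDual.ofDual g)).2

@[simp] theorem xExp_expo (a : ℝ) (β : ℕ →₀ ℝ) : xExp (expo a β) = a := rfl

@[simp] theorem logExp_expo (a : ℝ) (β : ℕ →₀ ℝ) : logExp (expo a β) = β := rfl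

@[simp] theorem expo_eta (g : Expo) : expo (xExp g) (logExp g) = g := rfl

theorem expo_add (a b : ℝ) (β γ : ℕ →₀ ℝ) : expo a β + expo b γ = expo (a + b) (β + γ) := rfl

theorem expo_inj {a b : ℝ} {β γ : ℕ →₀ ℝ} : expo a β = expo b γ ↔ a = b ∧ β = γ :=
  ⟨fun h => ⟨congrArg xExp h, congrArg logExp h⟩, fun h => by rw [h.1, h.2]⟩

/-- The iterated logarithmic algebra: formal sums, with Noetherian support and complex
coefficients, of monomials `x ^ a * ∏ j, ℓ_j ^ (β j)`. -/
abbrev IterLogAlg : Type := HahnSeries Expo ℂ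

/-- The monomial `x ^ a`. -/
def xPow (a : ℝ) : IterLogAlg := HahnSeries.single (expo a 0) 1

/-- The monomial `ℓ ^ α = ∏ j, ℓ_j ^ (α j)`. -/
def logMonomial (α : ℕ →₀ ℝ) : IterLogAlg := HahnSeries.single (expo 0 α) 1

/-- The vector `(1, …, 1, 0, 0, …)` with ones in the places `0, …, j`. -/
def ones (j : ℕ) : ℕ →₀ ℝ := ∑ i ∈ Finset.range (j + 1), Finsupp.single i 1

theorem ones_apply (j i : ℕ) : ones j i = if i ≤ j then 1 else 0 := by
  simp [ones, Finsupp.finsetSum_apply, Finsupp.single_apply]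

theorem ones_injective : Function.Injective ones := by
  intro i j h
  have h1 := DFunLike.congr_fun h i
  have h2 := DFunLike.congr_fun h j
  simp only [ones_apply, le_refl, if_true] at h1 h2
  have h3 : i ≤ j := by by_contra h; simp [h] at h1
  have h4 : j ≤ i := by by_contra h; simp [h] at h2
  exact le_antisymm h3 h4

/-- Exponents generated by those of the `(ℓ_0 ⋯ ℓ_j)⁻¹`. -/
def logCone : Set Expo := AddSubmonoid.closure (Set.range fun j : ℕ => expo 0 (-ones j))

/-- Exponents generated by `x⁻¹` and the `(ℓ_0 ⋯ ℓ_j)⁻¹`. -/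
def derivCone : Set Expo :=
  AddSubmonoid.closure ({expo (-1) 0} ∪ Set.range fun j : ℕ => expo 0 (-ones j))

theorem expo_log_mono : Monotone fun j : ℕ => expo 0 (-ones j) := by
  refine monotone_nat_of_le_succ fun j => ?_
  change toLex ((0 : ℝ), toLex (-ones (j + 1))) ≤ toLex ((0 : ℝ), toLex (-ones j))
  refine Prod.Lex.toLex_le_toLex.2 (Or.inr ⟨rfl, Finsupp.toLex_monotone fun i => ?_⟩)
  simp only [Finsupp.neg_apply, ones_apply]
  split_ifs with h1 h2 h2
  · exact le_refl _
  · norm_num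
  · exact absurd (Nat.le_succ_of_le h2) h1
  · norm_num

theorem expo_log_nonneg (j : ℕ) : 0 ≤ expo 0 (-ones j) := by
  change toLex ((0 : ℝ), toLex (-ones j)) ≤ toLex ((0 : ℝ), toLex (0 : ℕ →₀ ℝ))
  refine Prod.Lex.toLex_le_toLex.2 (Or.inr ⟨rfl, Finsupp.toLex_monotone fun i => ?_⟩)
  simp only [Finsupp.neg_apply, ones_apply, Finsupp.coe_zero, Pi.zero_apply]
  split_ifs <;> norm_num

theorem expo_inv_nonneg : 0 ≤ expo (-1) 0 := by
  change toLex ((-1 : ℝ), toLex (0 : ℕ →₀ ℝ)) ≤ toLex ((0 : ℝ), toLex (0 : ℕ →₀ ℝ))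
  exact Prod.Lex.toLex_le_toLex.2 (Or.inl (by norm_num))

theorem range_isPWO : (Set.range fun j : ℕ => expo 0 (-ones j)).IsPWO := by
  rw [← Set.image_univ]
  exact (Set.isPWO_of_wellQuasiOrderedLE _).image_of_monotone expo_log_mono

theorem logCone_isPWO : logCone.IsPWO := by
  refine Set.IsPWO.addSubmonoid_closure ?_ range_isPWO
  rintro _ ⟨j, rfl⟩
  exact expo_log_nonneg j

theorem derivCone_isPWO : derivCone.IsPWO := by
  refine Set.IsPWO.addSubmonoid_closure ?_ ((Set.isPWO_singleton _).union range_isPWO)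
  rintro _ (h | ⟨j, rfl⟩)
  · rw [Set.mem_singleton_iff.1 h]; exact expo_inv_nonneg
  · exact expo_log_nonneg j

/-- The coefficients of `x · dp/dx`; note that `x · dℓ_j/dx = (ℓ_0 ⋯ ℓ_(j-1))⁻¹`, so that
`x · d(x ^ a ℓ ^ γ)/dx = a x ^ a ℓ ^ γ + ∑ j, γ j • x ^ a ℓ ^ (γ - ones j)`. -/
def eulerCoeff (p : IterLogAlg) (g : Expo) : ℂ :=
  (xExp g : ℂ) * p.coeff g +
    ∑ᶠ j : ℕ, ((logExp g j : ℂ) + 1) * p.coeff (expo (xExp g) (logExp g + ones j))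

theorem eulerCoeff_support (p : IterLogAlg) :
    Function.support (eulerCoeff p) ⊆ p.support + logCone := by
  intro g hg
  by_contra hc
  refine hg ?_
  have h0 : p.coeff g = 0 := by
    by_contra h
    exact hc ⟨g, h, 0, AddSubmonoid.zero_mem _, add_zero g⟩
  have h1 : ∀ j : ℕ, p.coeff (expo (xExp g) (logExp g + ones j)) = 0 := by
    intro j
    by_contra h
    refine hc ⟨_, h, expo 0 (-ones j), AddSubmonoid.subset_closure ⟨j, rfl⟩, ?_⟩
    simp [expo_add]
  simp [eulerCoeff, h0, h1]

/-- The Euler operator `x · d/dx` on the iterated logarithmic algebra. -/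
def euler (p : IterLogAlg) : IterLogAlg where
  coeff := eulerCoeff p
  isPWO_support' := (p.isPWO_support.add logCone_isPWO).mono (eulerCoeff_support p)

/-- The derivative `D = d/dx` on the iterated logarithmic algebra. -/
def D (p : IterLogAlg) : IterLogAlg := xPow (-1) * euler p

theorem euler_iterate_support (p : IterLogAlg) (k : ℕ) :
    (euler^[k] p).support ⊆ p.support + logCone := by
  induction k with
  | zero => exact fun g hg => ⟨g, hg, 0, AddSubmonoid.zero_mem _, add_zero g⟩
  | succ k ih =>
    rw [Function.iterate_succ_apply']
    intro g hg
    obtain ⟨u, hu, v, hv, rfl⟩ := eulerCoeff_support _ hg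
    obtain ⟨s, hs, t, ht, rfl⟩ := ih hu
    exact ⟨s, hs, t + v, AddSubmonoid.add_mem _ ht hv, (add_assoc s t v).symm⟩

theorem D_iterate_support (p : IterLogAlg) (k : ℕ) :
    (D^[k] p).support ⊆ p.support + derivCone := by
  induction k with
  | zero => exact fun g hg => ⟨g, hg, 0, AddSubmonoid.zero_mem _, add_zero g⟩
  | succ k ih =>
    rw [Function.iterate_succ_apply']
    intro g hg
    obtain ⟨w, hw, r, hr, rfl⟩ := HahnSeries.support_mul_subset hg
    obtain ⟨u, hu, v, hv, rfl⟩ := eulerCoeff_support _ hr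
    obtain ⟨s, hs, t, ht, rfl⟩ := ih hu
    have hw' : w = expo (-1) 0 := by
      simpa using HahnSeries.support_single_subset hw
    refine ⟨s, hs, t + v + w, ?_, by simp only; abel⟩
    refine AddSubmonoid.add_mem _ (AddSubmonoid.add_mem _ ht ?_) ?_
    · exact AddSubmonoid.closure_mono Set.subset_union_right hv
    · exact AddSubmonoid.subset_closure (Or.inl hw')

/-- The action of the differential operator `f(D) = ∑ k, f_k D ^ k`. The sum converges
coefficientwise. -/
def diffOp (f : PowerSeries ℂ) (p : IterLogAlg) : IterLogAlg where
  coeff g := ∑ᶠ k : ℕ, PowerSeries.coeff k f * (D^[k] p).coeff g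
  isPWO_support' := by
    refine (p.isPWO_support.add derivCone_isPWO).mono fun g hg => ?_
    by_contra hc
    refine hg ?_
    have h : ∀ k : ℕ, (D^[k] p).coeff g = 0 := by
      intro k
      by_contra h
      exact hc (D_iterate_support p k h)
    simp [h]

/-! ### Harmonic logarithms -/

/-- The Roman factorial `⌊a⌉!`: it is `Γ(a + 1)` unless `a` is a negative integer, and
`(-1) ^ (a + 1) / (-a - 1)!` if `a` is a negative integer. -/
def romanFactorial (a : ℝ) : ℝ :=
  open Classical in
  if ∃ m : ℕ, a = -(m + 1) then
    (-1) ^ ⌊-a - 1⌋₊ / (Nat.factorial ⌊-a - 1⌋₊ : ℝ)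
  else Real.Gamma (a + 1)

/-- The Roman number `⌊a⌉`. -/
def romanNumber (a : ℝ) : ℝ := if a = 0 then 1 else a

theorem romanFactorial_ne_zero (a : ℝ) : romanFactorial a ≠ 0 := by
  unfold romanFactorial
  split_ifs with h
  · have := Nat.factorial_ne_zero ⌊-a - 1⌋₊
    positivity
  · refine Real.Gamma_ne_zero fun m hm => h ⟨m, by linarith⟩

/-- The generalized Stirling number `s(-a, k)`, that is the coefficient of `y ^ k` in the Taylor
series at `0` of the generalized lower factorial `(y)_(-a) = Γ(1 + y) / Γ(1 + a + y)`. (The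
reciprocal of `Γ` is entire, and `z / Γ = 0` at the poles of `Γ`.) -/
def stirlingNeg (a : ℝ) (k : ℕ) : ℂ :=
  iteratedDeriv k (fun y : ℂ => Complex.Gamma (1 + y) / Complex.Gamma (1 + a + y)) 0 /
    (Nat.factorial k : ℂ)

/-- The coefficient of `x ^ a ℓ ^ β` in the harmonic logarithm of degree `a` and order `α`. -/
def harmonicCoeff (a : ℝ) (α β : ℕ →₀ ℝ) : ℂ :=
  (romanFactorial a : ℂ) *
    ∑ᶠ k : ℕ, stirlingNeg a k * (euler^[k] (logMonomial α)).coeff (expo 0 β)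

theorem harmonicCoeff_mem {a : ℝ} {α β : ℕ →₀ ℝ} (h : harmonicCoeff a α β ≠ 0) :
    expo 0 β ∈ {expo 0 α} + logCone := by
  by_contra hc
  refine h ?_
  have h1 : ∀ k : ℕ, (euler^[k] (logMonomial α)).coeff (expo 0 β) = 0 := by
    intro k
    by_contra hk
    exact hc (Set.add_subset_add_right HahnSeries.support_single_subset
      (euler_iterate_support _ k hk))
  simp [harmonicCoeff, h1]

/-- The harmonic logarithm of degree `a` and order `α`,
`λ_a^α(x) = ⌊a⌉! x ^ a ∑ k, s(-a, k) (x d/dx) ^ k ℓ ^ α`. -/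
def harmonicLog (a : ℝ) (α : ℕ →₀ ℝ) : IterLogAlg where
  coeff g := if xExp g = a then harmonicCoeff a α (logExp g) else 0
  isPWO_support' := by
    refine ((Set.isPWO_singleton (expo a 0)).add
      ((Set.isPWO_singleton (expo 0 α)).add logCone_isPWO)).mono fun g hg => ?_
    rw [Function.mem_support, ne_eq, ite_eq_right_iff, Classical.not_imp] at hg
    refine ⟨_, rfl, _, harmonicCoeff_mem hg.2, ?_⟩
    simp [expo_add, ← hg.1]

/-- For a family of coefficients `s` with well-ordered support, the formal series
`∑ e, s_e D ^ e ℓ ^ α` of logarithmic type and of order `α`, where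
`D ^ e ℓ ^ α = λ_(-e)^α(x) / ⌊-e⌉!`. Thus the coefficient of `λ_b^α(x)` is `s_(-b) / ⌊b⌉!`. -/
def logSum (α : ℕ →₀ ℝ) (s : HahnSeries ℝ ℂ) : IterLogAlg where
  coeff g := s.coeff (-xExp g) / (romanFactorial (xExp g) : ℂ) *
    (harmonicLog (xExp g) α).coeff g
  isPWO_support' := by
    have hm : Monotone fun e : ℝ => expo (-e) 0 := by
      intro e e' h
      change toLex (-e', toLex (0 : ℕ →₀ ℝ)) ≤ toLex (-e, toLex (0 : ℕ →₀ ℝ))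
      rcases h.lt_or_eq with h | rfl
      · exact Prod.Lex.toLex_le_toLex.2 (Or.inl (by simpa using h))
      · exact le_refl _
    refine ((s.isPWO_support.image_of_monotone hm).add
      ((Set.isPWO_singleton (expo 0 α)).add logCone_isPWO)).mono fun g hg => ?_
    have h1 : s.coeff (-xExp g) ≠ 0 := fun h => hg (by simp [h])
    have h2 : harmonicCoeff (xExp g) α (logExp g) ≠ 0 := fun h =>
      hg (by simp [harmonicLog, h])
    refine ⟨_, ⟨_, h1, rfl⟩, _, harmonicCoeff_mem h2, ?_⟩
    simp [expo_add]

/-! The coefficients of a series of order `α ≠ (0)` are determined by the series. -/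

theorem euler_iterate_grading (α : ℕ →₀ ℝ) (k : ℕ) (g : Expo)
    (h : (euler^[k] (logMonomial α)).coeff g ≠ 0) :
    xExp g = 0 ∧ logExp g 0 = α 0 - k := by
  induction k generalizing g with
  | zero =>
    have hg : g = expo 0 α := by
      simpa using HahnSeries.support_single_subset (a := expo 0 α) (r := (1 : ℂ)) h
    simp [hg]
  | succ k ih =>
    rw [Function.iterate_succ_apply'] at h
    by_contra hc
    refine h ?_
    change eulerCoeff _ g = 0
    have h1 : (xExp g : ℂ) * (euler^[k] (logMonomial α)).coeff g = 0 := by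
      by_contra h0
      exact (left_ne_zero_of_mul h0) (by
        rw [(ih g (right_ne_zero_of_mul h0)).1]; simp)
    have h2 : ∀ j : ℕ,
        (euler^[k] (logMonomial α)).coeff (expo (xExp g) (logExp g + ones j)) = 0 := by
      intro j
      by_contra h0
      obtain ⟨h3, h4⟩ := ih _ h0
      refine hc ⟨h3, ?_⟩
      simp [ones_apply] at h4
      push_cast
      linarith
    simp [eulerCoeff, h1, h2]

theorem euler_logMonomial_coeff (α : ℕ →₀ ℝ) (j : ℕ) :
    (euler (logMonomial α)).coeff (expo 0 (α - ones j)) = α j := by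
  change eulerCoeff _ _ = _
  rw [eulerCoeff, finsum_eq_single _ j]
  · simp [logMonomial, ones_apply]
  · intro i hi
    rw [logMonomial, HahnSeries.coeff_single_of_ne, mul_zero]
    intro h
    have h1 := (expo_inj.1 h).2
    refine hi (ones_injective ?_)
    rw [logExp_expo] at h1
    have h2 : α - ones j + ones i = α - ones j + ones j := by rw [h1]; abel
    exact add_left_cancel h2

theorem harmonicCoeff_self (a : ℝ) (α : ℕ →₀ ℝ) :
    harmonicCoeff a α α = romanFactorial a * stirlingNeg a 0 := by
  rw [harmonicCoeff, finsum_eq_single _ 0]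
  · simp [logMonomial]
  · intro k hk
    by_contra h
    have h1 := (euler_iterate_grading α k _ (right_ne_zero_of_mul h)).2
    rw [logExp_expo] at h1
    have h2 : (k : ℝ) = 0 := by linarith
    exact hk (by exact_mod_cast h2)

theorem harmonicCoeff_sub (a : ℝ) (α : ℕ →₀ ℝ) (j : ℕ) :
    harmonicCoeff a α (α - ones j) = romanFactorial a * (stirlingNeg a 1 * α j) := by
  rw [harmonicCoeff, finsum_eq_single _ 1]
  · simp [euler_logMonomial_coeff]
  · intro k hk
    by_contra h
    have h1 := (euler_iterate_grading α k _ (right_ne_zero_of_mul h)).2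
    simp only [logExp_expo, Finsupp.sub_apply, ones_apply, zero_le, if_true] at h1
    have h2 : (k : ℝ) = 1 := by linarith
    exact hk (by exact_mod_cast h2)

theorem stirlingNeg_zero_ne {a : ℝ} (ha : ¬ ∃ m : ℕ, a = -(m + 1)) : stirlingNeg a 0 ≠ 0 := by
  have h : Complex.Gamma (1 + a) ≠ 0 := by
    refine Complex.Gamma_ne_zero fun m hm => ha ⟨m, ?_⟩
    have : (1 + a : ℝ) = -m := by exact_mod_cast hm
    linarith
  simpa [stirlingNeg] using h

theorem hasDerivAt_inv_Gamma (m : ℕ) : ∃ c : ℂ, c ≠ 0 ∧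
    HasDerivAt (fun y : ℂ => (Complex.Gamma (y - m))⁻¹) c 0 := by
  induction m with
  | zero =>
    refine ⟨1, one_ne_zero, ?_⟩
    have h1 : (fun y : ℂ => (Complex.Gamma (y - (0 : ℕ)))⁻¹) =
        fun y : ℂ => y * (Complex.Gamma (y + 1))⁻¹ := by
      funext y
      simpa using Complex.one_div_Gamma_eq_self_mul_one_div_Gamma_add_one y
    have h2 : DifferentiableAt ℂ (fun y : ℂ => (Complex.Gamma (y + 1))⁻¹) 0 :=
      (Complex.differentiable_one_div_Gamma.comp (differentiable_id.add_const (1 : ℂ))) 0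
    rw [h1]
    exact ((hasDerivAt_id (0 : ℂ)).mul h2.hasDerivAt).congr_deriv (by simp)
  | succ m ih =>
    obtain ⟨c, hc, hd⟩ := ih
    refine ⟨-((m : ℂ) + 1) * c, mul_ne_zero (neg_ne_zero.2 (Nat.cast_add_one_ne_zero m)) hc, ?_⟩
    have h1 : (fun y : ℂ => (Complex.Gamma (y - (m + 1 : ℕ)))⁻¹) =
        fun y : ℂ => (y - ((m : ℂ) + 1)) * (Complex.Gamma (y - m))⁻¹ := by
      funext y
      have := Complex.one_div_Gamma_eq_self_mul_one_div_Gamma_add_one (y - ((m : ℂ) + 1))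
      rw [show y - ((m : ℂ) + 1) + 1 = y - m by ring] at this
      simpa using this
    have h0 : Complex.Gamma (-(m : ℂ)) = 0 := Complex.Gamma_neg_nat_eq_zero m
    rw [h1]
    have h2 := ((hasDerivAt_id (0 : ℂ)).sub_const ((m : ℂ) + 1)).mul hd
    refine h2.congr_deriv ?_
    rw [zero_sub, h0]
    simp

theorem stirlingNeg_one_ne (m : ℕ) : stirlingNeg (-(m + 1)) 1 ≠ 0 := by
  obtain ⟨c, hc, hd⟩ := hasDerivAt_inv_Gamma m
  have h1 : DifferentiableAt ℂ (fun y : ℂ => Complex.Gamma (1 + y)) 0 := by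
    refine DifferentiableAt.comp (0 : ℂ) (Complex.differentiableAt_Gamma _ fun k hk => ?_)
      (differentiableAt_id.const_add (1 : ℂ))
    have : (1 + k : ℝ) = 0 := by
      have : (1 + k : ℂ) = 0 := by linear_combination hk
      exact_mod_cast this
    have hk : (0 : ℝ) ≤ k := Nat.cast_nonneg k
    linarith
  have h2 : (fun y : ℂ => Complex.Gamma (1 + y) /
      Complex.Gamma (1 + ((-(m + 1) : ℝ) : ℂ) + y)) =
      fun y : ℂ => Complex.Gamma (1 + y) * (Complex.Gamma (y - m))⁻¹ := by
    funext y
    rw [div_eq_mul_inv]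
    congr 3
    push_cast
    ring
  have h0 : Complex.Gamma (-(m : ℂ)) = 0 := Complex.Gamma_neg_nat_eq_zero m
  have h3 := (h1.hasDerivAt.mul hd).deriv
  rw [stirlingNeg, iteratedDeriv_one, h2]
  have h4 : deriv (fun y : ℂ => Complex.Gamma (1 + y) * (Complex.Gamma (y - m))⁻¹) 0 = c := by
    refine Eq.trans h3 ?_
    simp [h0]
  rw [h4]
  simpa using hc

theorem exists_harmonicCoeff_ne {α : ℕ →₀ ℝ} (hα : α ≠ 0) (a : ℝ) :
    ∃ β, harmonicCoeff a α β ≠ 0 := by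
  have hr : (romanFactorial a : ℂ) ≠ 0 := by exact_mod_cast romanFactorial_ne_zero a
  by_cases ha : ∃ m : ℕ, a = -(m + 1)
  · obtain ⟨m, rfl⟩ := ha
    obtain ⟨j, hj⟩ := DFunLike.ne_iff.1 hα
    refine ⟨α - ones j, ?_⟩
    rw [harmonicCoeff_sub]
    exact mul_ne_zero hr (mul_ne_zero (stirlingNeg_one_ne m) (by exact_mod_cast hj))
  · exact ⟨α, by rw [harmonicCoeff_self]; exact mul_ne_zero hr (stirlingNeg_zero_ne ha)⟩

theorem logSum_injective {α : ℕ →₀ ℝ} (hα : α ≠ 0) : Function.Injective (logSum α) := by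
  intro s t h
  ext e
  obtain ⟨β, hβ⟩ := exists_harmonicCoeff_ne hα (-e)
  have hr : (romanFactorial (-e) : ℂ) ≠ 0 := by exact_mod_cast romanFactorial_ne_zero (-e)
  have h1 := congrArg (fun p : IterLogAlg => p.coeff (expo (-e) β)) h
  simp only [logSum, harmonicLog, xExp_expo, logExp_expo, if_true, neg_neg] at h1
  have h2 := mul_right_cancel₀ hβ h1
  exact (div_left_inj' hr).1 h2

/-! ### Artinian operators and powers of differential operators -/

/-- The inverse of `logSum α`, for `α ≠ (0)` and a series of order `α`. -/
def coords (α : ℕ →₀ ℝ) : IterLogAlg → HahnSeries ℝ ℂ := Function.invFun (logSum α)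

theorem coords_logSum {α : ℕ →₀ ℝ} (hα : α ≠ 0) (s : HahnSeries ℝ ℂ) :
    coords α (logSum α s) = s :=
  Function.leftInverse_invFun (logSum_injective hα) s

/-- The action of the Artinian operator `g(D) = ∑ b, g_b D ^ b` (real exponents `b`, well-ordered
support) on the series of order `α ≠ (0)`. It is given by `D ^ b (D ^ e ℓ ^ α) = D ^ (b + e) ℓ ^ α`,
that is by `D ^ b λ_a^α(x) = (⌊a⌉! / ⌊a - b⌉!) λ_(a - b)^α(x)`. -/
def artinianOp (α : ℕ →₀ ℝ) (g : HahnSeries ℝ ℂ) (p : IterLogAlg) : IterLogAlg :=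
  logSum α (g * coords α p)

/-- The `n`-th logarithm `log c + 2πin`. -/
def branchLog (c : ℂ) (n : ℤ) : ℂ := Complex.log c + 2 * Real.pi * Complex.I * n

/-- The power `u ^ b` of a power series with nonzero constant term `c`, for the choice `L` of a
logarithm of `c`: it is `exp (b L) * ∑ k, (b choose k) (u / c - 1) ^ k`. -/
def branchPow (u : PowerSeries ℂ) (L : ℂ) (b : ℝ) : PowerSeries ℂ :=
  PowerSeries.C (Complex.exp (b * L)) *
    (PowerSeries.binomialSeries ℂ (b : ℂ)).subst
      (PowerSeries.C (PowerSeries.constantCoeff u)⁻¹ * u - 1)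

/-- The integer power of a power series with nonzero constant term. -/
def intPow (u : PowerSeries ℂ) : ℤ → PowerSeries ℂ
  | Int.ofNat k => u ^ k
  | Int.negSucc k => u⁻¹ ^ (k + 1)

/-- `f(D) / D` for a differential operator `f(D)` without constant term. -/
def divD (f : PowerSeries ℂ) : PowerSeries ℂ := PowerSeries.mk fun k => PowerSeries.coeff (k + 1) f

/-- For `f(D)` of degree one with leading coefficient `c`, the Artinian operator
`f(D) ^ (b;n) = c ^ (b;n) D ^ b (f(D) / (c D)) ^ b` with `c ^ (b;n) = exp (b (log c + 2πin))`. -/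
def artinianPow (f : PowerSeries ℂ) (n : ℤ) (b : ℝ) : HahnSeries ℝ ℂ :=
  HahnSeries.single b 1 *
    HahnSeries.ofPowerSeries ℝ ℂ
      (branchPow (divD f) (branchLog (PowerSeries.coeff 1 f) n) b)

/-- The operator `(D / f(D)) ^ (b;n)`, a differential operator of degree zero, for the branch
reciprocal to that of `f(D) ^ (b;n)`; so `(D / f(D)) ^ (b;n) = D ^ b f(D) ^ (-b;n)`. -/
def ratioPow (f : PowerSeries ℂ) (n : ℤ) (b : ℝ) : PowerSeries ℂ :=
  branchPow (divD f)⁻¹ (-branchLog (PowerSeries.coeff 1 f) n) b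

/-! ### Graded sequences and associated graded sequences -/

/-- `q` consists of series `q^α` of order `α` and of degree `a` (the exponents of `x` lying in `E`)
whose coefficients `[λ_b^α(x)] q^α(x)` do not depend on `α ∈ S`. -/
def IsRegularOfDegree (E : Set ℝ) (S : Set (ℕ →₀ ℝ)) (a : ℝ) (q : (ℕ →₀ ℝ) → IterLogAlg) : Prop :=
  ∃ s : HahnSeries ℝ ℂ, (∀ e ∈ s.support, -e ∈ E) ∧ s.orderTop = ((-a : ℝ) : WithTop ℝ) ∧
    ∀ α ∈ S, q α = logSum α s

/-- The augmentation `⟨p⟩_α`, that is the coefficient of `λ_0^α(x) = ℓ ^ α` in `p`. -/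
def augmentation (α : ℕ →₀ ℝ) (p : IterLogAlg) : ℂ := p.coeff (expo 0 α)

/-- Discrete case: `p` is the associated graded sequence of `f(D)`. -/
structure IsDiscreteAssociated (S : Set (ℕ →₀ ℝ)) (f : PowerSeries ℂ)
    (p : ℤ → (ℕ →₀ ℝ) → IterLogAlg) : Prop where
  graded : ∀ a : ℤ, IsRegularOfDegree (Set.range ((↑) : ℤ → ℝ)) S a (p a)
  augmentation_zero : ∀ α ∈ S, augmentation α (p 0 α) = 1
  augmentation_ne : ∀ α ∈ S, ∀ a : ℤ, a ≠ 0 → augmentation α (p a α) = 0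
  lowering : ∀ α ∈ S, α ≠ 0 → ∀ a : ℤ,
    diffOp f (p a α) = (romanNumber a : ℂ) • p (a - 1) α

/-- Continuous case: `p` is the `n`-th associated graded sequence of `f(D)`. -/
structure IsAssociated (S : Set (ℕ →₀ ℝ)) (f : PowerSeries ℂ) (n : ℤ)
    (p : ℝ → (ℕ →₀ ℝ) → IterLogAlg) : Prop where
  graded : ∀ a : ℝ, IsRegularOfDegree Set.univ S a (p a)
  augmentation_zero : ∀ α ∈ S, augmentation α (p 0 α) = 1
  augmentation_ne : ∀ α ∈ S, ∀ a : ℝ, a ≠ 0 → augmentation α (p a α) = 0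
  lowering : ∀ α ∈ S, α ≠ 0 → ∀ a b : ℝ,
    artinianOp α (artinianPow f n b) (p a α) =
      ((romanFactorial a / romanFactorial (a - b) : ℝ) : ℂ) • p (a - b) α

end

end IterLog

namespace IterLog

open PowerSeries

/-! ### Real powers of power series -/

/-! Relative to the basis `λ_b^α / ⌊b⌉!`, written `T ^ (-b)`, the derivative `D` is multiplication
by `T` (`D_logSum`). This reflects the recursion `s(-(a-1), k+1) = a s(-a, k+1) + s(-a, k)`, that
is, the functional equation of `Γ`. A differential operator thus becomes multiplication by a power
series (`diffOp_logSum`), for every order including `(0)`, and the problem moves to Hahn series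
`s_a` in `T` that do not depend on `α`. Since `logSum` is injective at the order `(1)`, that single
order determines them.

Put `u = f / T`. The lowering law gives `s_a = ⌊a⌉! T ^ (-a) u ^ (-a) s_0`, so the augmentation
conditions say that the coefficient of `T ^ a` in `u ^ (-a) s_0` is `1` for `a = 0` and `0`
otherwise. These conditions are triangular: tested at the lowest exponent of a difference of two
solutions, they force it to vanish (`eq_ofPowerSeries_of_coeff_eq`). The series `f' u⁻¹` is a
solution: at a natural number `m` the coefficient is the residue of `f' / f ^ (m+1)`, which is `1`
for `m = 0` and otherwise `0`, the residue of a derivative (`coeff_inv_divD_pow_mul`); at any other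
exponent a power series has no coefficient. Hence `s_0 = f' u⁻¹` and `s_a = ⌊a⌉! T ^ (-a) f' u ^
(-a-1)`, which is the formula. -/

theorem one_add_X_mul_derivative_binomialSeries (b : ℂ) :
    (1 + X) * derivative ℂ (PowerSeries.binomialSeries ℂ b) = C b * PowerSeries.binomialSeries ℂ b := by
  have h : ∀ n : ℕ, Ring.choose b (n + 1) * (n + 1) = Ring.choose b n * (b - n) := by
    intro n
    have h1 := Ring.choose_smul_choose b (Nat.le_succ n)
    simp only [Nat.succ_eq_add_one, Nat.choose_succ_self_right, add_tsub_cancel_left,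
      Ring.choose_one_right, nsmul_eq_mul] at h1
    push_cast at h1
    linear_combination h1
  ext n
  rw [add_mul, one_mul, map_add, coeff_C_mul]
  cases n with
  | zero =>
    have := h 0
    simp only [zero_add, Nat.cast_zero, mul_one, sub_zero] at this
    simp [coeff_derivative, this]
  | succ n =>
    have h1 := h (n + 1)
    rw [coeff_succ_X_mul, coeff_derivative, coeff_derivative]
    simp only [binomialSeries_coeff, smul_eq_mul, mul_one]
    push_cast at h1 ⊢
    linear_combination h1

/-- The power `(1 + w) ^ b` of a power series with constant term `1`. -/
noncomputable def binomPow (b : ℂ) (w : PowerSeries ℂ) : PowerSeries ℂ :=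
  (PowerSeries.binomialSeries ℂ b).subst w

section binomPow

variable {w : PowerSeries ℂ} (hw : constantCoeff w = 0)

include hw

theorem binomPow_add (b b' : ℂ) : binomPow (b + b') w = binomPow b w * binomPow b' w := by
  rw [binomPow, binomialSeries_add, subst_mul (HasSubst.of_constantCoeff_zero' hw)]; rfl

theorem binomPow_natCast (n : ℕ) : binomPow n w = (1 + w) ^ n := by
  have hs := HasSubst.of_constantCoeff_zero' hw
  have h1 : (1 : PowerSeries ℂ).subst w = (1 : PowerSeries ℂ) := by
    rw [← coe_substAlgHom hs, map_one]
  rw [binomPow, binomialSeries_nat, subst_pow hs, subst_add hs, subst_X hs, h1]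

theorem binomPow_mul_neg (b : ℂ) : binomPow b w * binomPow (-b) w = 1 := by
  rw [← binomPow_add hw, add_neg_cancel, ← Nat.cast_zero, binomPow_natCast hw, pow_zero]

theorem constantCoeff_binomPow (b : ℂ) : constantCoeff (binomPow b w) = 1 := by
  have hs := HasSubst.of_constantCoeff_zero' hw
  have h : PowerSeries.binomialSeries ℂ b = 1 + (PowerSeries.binomialSeries ℂ b - 1) := by ring
  have h1 : (1 : PowerSeries ℂ).subst w = (1 : PowerSeries ℂ) := by
    rw [← coe_substAlgHom hs, map_one]
  rw [binomPow, h, subst_add hs, h1, map_add]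
  have := constantCoeff_subst_eq_zero hw (PowerSeries.binomialSeries ℂ b - 1) (by simp)
  rw [map_one, add_eq_left]
  exact this

theorem one_add_mul_derivative_binomPow (b : ℂ) :
    (1 + w) * derivative ℂ (binomPow b w) = C b * binomPow b w * derivative ℂ w := by
  have hs := HasSubst.of_constantCoeff_zero' hw
  have h1 : (1 : PowerSeries ℂ).subst w = (1 : PowerSeries ℂ) := by
    rw [← coe_substAlgHom hs, map_one]
  have h := congrArg (fun g : PowerSeries ℂ => g.subst w)
    (one_add_X_mul_derivative_binomialSeries b)
  simp only [subst_mul hs, subst_add hs, subst_X hs, h1] at h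
  have h2 : (C b : PowerSeries ℂ).subst w = (C b : PowerSeries ℂ) := subst_C b
  rw [h2] at h
  rw [binomPow, derivative_subst hs, ← mul_assoc, h]

/-- The logarithmic derivative of the product is `b` times that of `(1 + w) * (1 + w') = 1`, hence
zero, and the constant term is `1`. -/
theorem binomPow_mul_binomPow_inv {w' : PowerSeries ℂ} (hw' : constantCoeff w' = 0)
    (h : (1 + w) * (1 + w') = 1) (b : ℂ) : binomPow b w * binomPow b w' = 1 := by
  refine derivative.ext ?_ ?_
  · have h1 := one_add_mul_derivative_binomPow hw b
    have h2 := one_add_mul_derivative_binomPow hw' b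
    have h3 := congrArg (derivative ℂ) h
    simp only [Derivation.leibniz, smul_eq_mul, map_add, Derivation.map_one_eq_zero,
      zero_add] at h3 ⊢
    generalize derivative ℂ (binomPow b w) = Y' at *
    generalize derivative ℂ (binomPow b w') = Z' at *
    generalize binomPow b w = Y at *
    generalize binomPow b w' = Z at *
    linear_combination (-(Y * Z' + Z * Y')) * h + Y * (1 + w) * h2 + Z * (1 + w') * h1 +
      C b * Y * Z * h3
  · simp [constantCoeff_binomPow hw, constantCoeff_binomPow hw']

end binomPow

/-! ### Powers for a chosen logarithm of the constant term -/

theorem branchPow_eq (u : PowerSeries ℂ) (L : ℂ) (b : ℝ) : branchPow u L b =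
    C (Complex.exp (b * L)) * binomPow b (C (constantCoeff u)⁻¹ * u - 1) := rfl

section branchPow

variable {u : PowerSeries ℂ} {L : ℂ} (hu : Complex.exp L = constantCoeff u)

include hu

theorem constantCoeff_ne_zero_of_exp : constantCoeff u ≠ 0 := hu ▸ Complex.exp_ne_zero L

theorem constantCoeff_normalize : constantCoeff (C (constantCoeff u)⁻¹ * u - 1) = 0 := by
  simp [constantCoeff_ne_zero_of_exp hu]

theorem constantCoeff_branchPow (b : ℝ) : constantCoeff (branchPow u L b) ≠ 0 := by
  rw [branchPow_eq, map_mul, constantCoeff_binomPow (constantCoeff_normalize hu)]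
  simp

/-- At integer exponents the choice of logarithm disappears. The residue computation needs only
these exponents, so it is independent of the branch. -/
theorem branchPow_neg_natCast (m : ℕ) : branchPow u L (-m) = u⁻¹ ^ m := by
  have hc := constantCoeff_ne_zero_of_exp hu
  have hw := constantCoeff_normalize hu
  have h1 := binomPow_mul_neg hw m
  rw [binomPow_natCast hw, add_sub_cancel] at h1
  have h2 : u⁻¹ ^ m * u ^ m = 1 := by rw [← mul_pow, PowerSeries.inv_mul_cancel _ hc, one_pow]
  have h3 : Complex.exp ((-m : ℝ) * L) = (constantCoeff u)⁻¹ ^ m := by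
    rw [← hu, ← Complex.exp_neg, ← Complex.exp_nat_mul]; push_cast; ring_nf
  rw [branchPow_eq, h3, map_pow]
  push_cast
  rw [mul_pow] at h1
  linear_combination u⁻¹ ^ m * h1 - C (constantCoeff u)⁻¹ ^ m *
    binomPow (-m) (C (constantCoeff u)⁻¹ * u - 1) * h2

theorem branchPow_zero : branchPow u L 0 = 1 := by
  simpa using branchPow_neg_natCast hu 0

/-- Converts the `u ^ (-a-1)` produced by solving the recursion into the power of `D / f(D)` in the
formula; the reciprocal branch `-L` makes the exponential factors agree. -/
theorem branchPow_neg_mul_inv (a : ℝ) :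
    branchPow u L (-a) * u⁻¹ = branchPow u⁻¹ (-L) (a + 1) := by
  have hc := constantCoeff_ne_zero_of_exp hu
  have hu' : Complex.exp (-L) = constantCoeff u⁻¹ := by
    rw [Complex.exp_neg, hu, constantCoeff_inv]
  have hw := constantCoeff_normalize hu
  have hw' := constantCoeff_normalize hu'
  have hCC : (C (constantCoeff u)⁻¹ : PowerSeries ℂ) * C (constantCoeff u) = 1 := by
    rw [← map_mul, inv_mul_cancel₀ hc, map_one]
  have h1 := binomPow_mul_neg hw a
  have h2 := binomPow_mul_binomPow_inv hw hw' (by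
    simp only [add_sub_cancel, constantCoeff_inv, inv_inv]
    linear_combination hCC * u * u⁻¹ + PowerSeries.mul_inv_cancel _ hc) a
  have h3 : Complex.exp (((a + 1 : ℝ) : ℂ) * -L) =
      Complex.exp ((-a : ℝ) * L) * (constantCoeff u)⁻¹ := by
    rw [← hu, ← Complex.exp_neg, ← Complex.exp_add]; push_cast; ring_nf
  rw [branchPow_eq u, branchPow_eq u⁻¹, h3]
  push_cast
  have h4 := binomPow_natCast hw' 1
  rw [Nat.cast_one] at h4
  rw [binomPow_add hw', h4, map_mul]
  simp only [add_sub_cancel, constantCoeff_inv, inv_inv, pow_one] at h2 ⊢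
  generalize binomPow (a : ℂ) (C (constantCoeff u)⁻¹ * u - 1) = A at *
  generalize binomPow (-a : ℂ) (C (constantCoeff u)⁻¹ * u - 1) = B at *
  generalize binomPow (a : ℂ) (C (constantCoeff u) * u⁻¹ - 1) = A' at *
  -- Both are inverses of `A`.
  have h5 : B = A' := by linear_combination A' * h1 - B * h2
  rw [h5]
  linear_combination (-(C (Complex.exp (-a * L)) * A' * u⁻¹)) * hCC

end branchPow

/-! ### The residue of a logarithmic derivative -/

theorem eq_X_mul_divD {f : PowerSeries ℂ} (hf : constantCoeff f = 0) : f = X * divD f := by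
  ext n
  cases n with
  | zero => simpa using hf
  | succ n => rw [coeff_succ_X_mul, divD, coeff_mk]

theorem constantCoeff_divD (f : PowerSeries ℂ) : constantCoeff (divD f) = coeff 1 f := by
  rw [← coeff_zero_eq_constantCoeff_apply, divD, coeff_mk]

theorem constantCoeff_derivative_mul_inv {f : PowerSeries ℂ} (h1 : coeff 1 f ≠ 0) :
    constantCoeff (derivative ℂ f * (divD f)⁻¹) = 1 := by
  rw [map_mul, constantCoeff_inv, constantCoeff_divD, ← coeff_zero_eq_constantCoeff_apply,
    coeff_derivative]
  simp [h1]

/-- This coefficient is the residue of `f' / f ^ (m+1)`, the derivative of `-f ^ (-m) / m`. The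
proof stays within power series by means of `X d/dX`. -/
theorem coeff_inv_divD_pow_mul {f : PowerSeries ℂ} (h0 : constantCoeff f = 0)
    (h1 : coeff 1 f ≠ 0) {m : ℕ} (hm : m ≠ 0) :
    coeff m ((divD f)⁻¹ ^ m * (derivative ℂ f * (divD f)⁻¹)) = 0 := by
  have hc : constantCoeff (divD f) ≠ 0 := by rwa [constantCoeff_divD]
  obtain ⟨m, rfl⟩ := Nat.exists_eq_succ_of_ne_zero hm
  have hd : derivative ℂ f = divD f + X * derivative ℂ (divD f) := by
    conv_lhs => rw [eq_X_mul_divD h0]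
    simp [Derivation.leibniz, add_comm]
  generalize divD f = u at *
  have hi := PowerSeries.mul_inv_cancel u hc
  have hp := derivative_pow u⁻¹ (m + 1)
  rw [derivative_inv', add_tsub_cancel_right] at hp
  have hne : ((m : ℂ) + 1) ≠ 0 := Nat.cast_add_one_ne_zero m
  -- `X d/dX` multiplies the coefficient of `X ^ (m+1)` by `m + 1`, so the right side has none in
  -- that degree.
  have key : C ((m : ℂ) + 1) * (u⁻¹ ^ (m + 1) * (derivative ℂ f * u⁻¹)) =
      C ((m : ℂ) + 1) * u⁻¹ ^ (m + 1) - X * derivative ℂ (u⁻¹ ^ (m + 1)) := by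
    rw [hp, hd]
    push_cast
    rw [map_add, map_one, map_natCast]
    linear_combination ((m : PowerSeries ℂ) + 1) * u⁻¹ ^ (m + 1) * hi
  have h2 := congrArg (coeff (m + 1)) key
  rw [coeff_C_mul, map_sub, coeff_C_mul, coeff_succ_X_mul, coeff_derivative, mul_comm (coeff _ _),
    sub_self] at h2
  exact (mul_eq_zero.1 h2).resolve_left hne

end IterLog

namespace IterLog

/-! ### The derivative of a series of logarithmic type -/

theorem contDiffAt_Gamma_div_Gamma (a : ℝ) (n : ℕ) :
    ContDiffAt ℂ n (fun y : ℂ => Complex.Gamma (1 + y) / Complex.Gamma (1 + a + y)) 0 := by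
  have h1 : AnalyticAt ℂ (fun y : ℂ => Complex.Gamma (1 + y)) 0 := by
    rw [Complex.analyticAt_iff_eventually_differentiableAt]
    have h : ∀ᶠ y : ℂ in nhds 0, 0 < (1 + y).re := by
      refine ContinuousAt.eventually_lt continuousAt_const ?_ (by simp)
      fun_prop
    filter_upwards [h] with y hy
    refine DifferentiableAt.comp y (Complex.differentiableAt_Gamma _ fun k hk => ?_)
      (differentiableAt_id.const_add (1 : ℂ))
    rw [show 1 + y = -(k : ℂ) from hk, Complex.neg_re, Complex.natCast_re] at hy
    have : (0 : ℝ) ≤ k := Nat.cast_nonneg k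
    linarith
  have h2 : Differentiable ℂ (fun y : ℂ => (Complex.Gamma (1 + a + y))⁻¹) :=
    Complex.differentiable_one_div_Gamma.comp (differentiable_id.const_add (1 + a : ℂ))
  simp only [div_eq_mul_inv]
  exact (h1.mul (h2.analyticAt 0)).contDiffAt

/-- The functional equation is used for the entire function `1 / Γ`, so poles need no exception. -/
theorem Gamma_div_Gamma_sub_one (a : ℝ) :
    (fun y : ℂ => Complex.Gamma (1 + y) / Complex.Gamma (1 + ((a - 1 : ℝ) : ℂ) + y)) =
      (fun y : ℂ => (a : ℂ) + y) *
        fun y : ℂ => Complex.Gamma (1 + y) / Complex.Gamma (1 + a + y) := by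
  funext y
  have h := Complex.one_div_Gamma_eq_self_mul_one_div_Gamma_add_one ((a : ℂ) + y)
  rw [Pi.mul_apply, div_eq_mul_inv, div_eq_mul_inv,
    show 1 + ((a - 1 : ℝ) : ℂ) + y = a + y by push_cast; ring, h,
    show (a : ℂ) + y + 1 = 1 + a + y by ring]
  ring

theorem stirlingNeg_sub_one_zero (a : ℝ) : stirlingNeg (a - 1) 0 = a * stirlingNeg a 0 := by
  simp only [stirlingNeg, Gamma_div_Gamma_sub_one, iteratedDeriv_zero, Pi.mul_apply]
  simp

/-- Leibniz' rule for a product with the factor `a + y`, whose derivatives of order two and more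
vanish. -/
theorem stirlingNeg_sub_one_succ (a : ℝ) (k : ℕ) :
    stirlingNeg (a - 1) (k + 1) = a * stirlingNeg a (k + 1) + stirlingNeg a k := by
  have hl : ContDiffAt ℂ (k + 1 : ℕ) (fun y : ℂ => (a : ℂ) + y) 0 :=
    contDiffAt_const.add contDiffAt_id
  have hi : ∀ i : ℕ, iteratedDeriv i (fun y : ℂ => (a : ℂ) + y) 0 =
      if i = 0 then (a : ℂ) else if i = 1 then 1 else 0 := by
    intro i
    rcases Nat.eq_zero_or_pos i with rfl | h
    · simp
    · rw [iteratedDeriv_const_add h, iteratedDeriv_fun_id_zero, if_neg h.ne']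
  rw [stirlingNeg, Gamma_div_Gamma_sub_one,
    iteratedDeriv_mul hl (contDiffAt_Gamma_div_Gamma a (k + 1)), Finset.sum_range_succ',
    Finset.sum_range_succ', Finset.sum_eq_zero]
  · have hk : ((k : ℂ) + 1) ≠ 0 := Nat.cast_add_one_ne_zero k
    have hk' : (k.factorial : ℂ) ≠ 0 := Nat.cast_ne_zero.2 k.factorial_ne_zero
    simp only [hi, stirlingNeg, Nat.factorial_succ]
    simp
    field_simp
    ring
  · intro i _
    simp [hi]

/-- The coefficient of `x ^ a ℓ ^ β` in `λ_a^α(x) / ⌊a⌉!`. -/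
noncomputable def unitCoeff (a : ℝ) (α β : ℕ →₀ ℝ) : ℂ :=
  ∑ᶠ k : ℕ, stirlingNeg a k * (euler^[k] (logMonomial α)).coeff (expo 0 β)

/-- Each `x d/dx` lowers the exponent of `log x` by one, so a monomial occurs for at most one `k`.
-/
theorem unitCoeff_eq {a : ℝ} {α β : ℕ →₀ ℝ} {k : ℕ} (h : β 0 = α 0 - k) :
    unitCoeff a α β = stirlingNeg a k * (euler^[k] (logMonomial α)).coeff (expo 0 β) := by
  refine finsum_eq_single _ k fun i hi => ?_
  by_contra h0
  have h1 := (euler_iterate_grading α i _ (right_ne_zero_of_mul h0)).2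
  rw [logExp_expo] at h1
  have h2 : (i : ℝ) = k := by linarith
  exact hi (by exact_mod_cast h2)

theorem unitCoeff_eq_zero {a : ℝ} {α β : ℕ →₀ ℝ} (h : ¬ ∃ k : ℕ, β 0 = α 0 - k) :
    unitCoeff a α β = 0 := by
  refine finsum_eq_zero_of_forall_eq_zero fun i => ?_
  by_contra h0
  exact h ⟨i, (euler_iterate_grading α i _ (right_ne_zero_of_mul h0)).2⟩

/-- Coefficientwise form of `D (λ_a / ⌊a⌉!) = λ_(a-1) / ⌊a-1⌉!`: the left side is the action of `x
d/dx` on `x ^ a ℓ ^ β`, and the Stirling recursion turns it into the right side. -/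
theorem unitCoeff_sub_one (a : ℝ) (α β : ℕ →₀ ℝ) :
    a * unitCoeff a α β + ∑ᶠ j : ℕ, ((β j : ℂ) + 1) * unitCoeff a α (β + ones j) =
      unitCoeff (a - 1) α β := by
  have h0 : ∀ j : ℕ, (β + ones j) 0 = β 0 + 1 := fun j => by simp [ones_apply]
  by_cases h : ∃ k : ℕ, β 0 = α 0 - k
  · obtain ⟨k, hk⟩ := h
    rw [unitCoeff_eq hk, unitCoeff_eq hk]
    cases k with
    | zero =>
      have h1 : ∀ j : ℕ, unitCoeff a α (β + ones j) = 0 := by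
        refine fun j => unitCoeff_eq_zero ?_
        rintro ⟨i, hi⟩
        rw [h0, hk] at hi
        have : (0 : ℝ) ≤ i := Nat.cast_nonneg i
        push_cast at hi
        linarith
      simp only [h1, mul_zero, finsum_zero, add_zero, stirlingNeg_sub_one_zero]
      ring
    | succ k =>
      have h1 : ∀ j : ℕ, unitCoeff a α (β + ones j) =
          stirlingNeg a k * (euler^[k] (logMonomial α)).coeff (expo 0 (β + ones j)) := by
        refine fun j => unitCoeff_eq ?_
        rw [h0, hk]
        push_cast
        ring
      have h2 : (euler^[k + 1] (logMonomial α)).coeff (expo 0 β) =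
          ∑ᶠ j : ℕ, ((β j : ℂ) + 1) *
            (euler^[k] (logMonomial α)).coeff (expo 0 (β + ones j)) := by
        rw [Function.iterate_succ_apply']
        change eulerCoeff _ _ = _
        simp [eulerCoeff]
      rw [stirlingNeg_sub_one_succ, h2]
      simp only [h1, mul_left_comm _ (stirlingNeg a k), ← mul_finsum]
      ring
  · have h1 : ∀ j : ℕ, unitCoeff a α (β + ones j) = 0 := by
      refine fun j => unitCoeff_eq_zero ?_
      rintro ⟨i, hi⟩
      rw [h0] at hi
      exact h ⟨i + 1, by push_cast; linarith⟩
    simp [h1, unitCoeff_eq_zero h]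

theorem coeff_logSum (α : ℕ →₀ ℝ) (s : HahnSeries ℝ ℂ) (g : Expo) :
    (logSum α s).coeff g = s.coeff (-xExp g) * unitCoeff (xExp g) α (logExp g) := by
  have hr : (romanFactorial (xExp g) : ℂ) ≠ 0 := by exact_mod_cast romanFactorial_ne_zero _
  have h : (logSum α s).coeff g = s.coeff (-xExp g) / (romanFactorial (xExp g) : ℂ) *
      (if xExp g = xExp g then romanFactorial (xExp g) * unitCoeff (xExp g) α (logExp g)
        else 0) := rfl
  rw [h, if_pos rfl]
  field_simp

theorem D_logSum (α : ℕ →₀ ℝ) (s : HahnSeries ℝ ℂ) :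
    D (logSum α s) = logSum α (HahnSeries.single 1 1 * s) := by
  ext g
  rw [D, xPow, HahnSeries.coeff_single_mul, one_mul, coeff_logSum, HahnSeries.coeff_single_mul,
    one_mul]
  have hg : g - expo (-1) 0 = expo (xExp g + 1) (logExp g) := by
    rw [sub_eq_iff_eq_add, expo_add]
    simp
  rw [hg]
  change eulerCoeff _ _ = _
  rw [eulerCoeff]
  simp only [coeff_logSum, xExp_expo, logExp_expo, mul_left_comm _ (s.coeff _), ← mul_finsum,
    ← mul_add, unitCoeff_sub_one]
  rw [add_sub_cancel_right, neg_add']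

theorem D_iterate_logSum (α : ℕ →₀ ℝ) (s : HahnSeries ℝ ℂ) (k : ℕ) :
    D^[k] (logSum α s) = logSum α (HahnSeries.single (k : ℝ) 1 * s) := by
  induction k with
  | zero =>
    rw [Nat.cast_zero, ← HahnSeries.C_apply, map_one, one_mul]; rfl
  | succ k ih =>
    rw [Function.iterate_succ_apply', ih, D_logSum, ← mul_assoc, HahnSeries.single_mul_single,
      one_mul, Nat.cast_succ, add_comm]

/-! ### Differential operators in terms of coordinates -/

theorem exists_natCast_of_coeff_ofPowerSeries_ne_zero {g : PowerSeries ℂ} {e : ℝ}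
    (h : (HahnSeries.ofPowerSeries ℝ ℂ g).coeff e ≠ 0) : ∃ n : ℕ, (n : ℝ) = e := by
  by_contra hc
  exact h (HahnSeries.embDomain_of_notMem_range fun ⟨n, hn⟩ => hc ⟨n, hn⟩)

/-- The first factor has natural exponents only, so the antidiagonal is indexed by `k ↦ (k, e - k)`.
This is the shape of the sum defining `diffOp`. -/
theorem coeff_ofPowerSeries_mul (g : PowerSeries ℂ) (s : HahnSeries ℝ ℂ) (e : ℝ) :
    (HahnSeries.ofPowerSeries ℝ ℂ g * s).coeff e =
      ∑ᶠ k : ℕ, PowerSeries.coeff k g * s.coeff (e - k) := by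
  have hinj : Function.Injective fun k : ℕ => ((k : ℝ), e - k) := fun i j h => by
    simpa using (Prod.ext_iff.1 h).1
  rw [HahnSeries.coeff_mul, finsum_eq_sum_of_support_subset (s := (Finset.antidiagonal
    (HahnSeries.ofPowerSeries ℝ ℂ g).isPWO_support s.isPWO_support e).preimage _ hinj.injOn),
    ← Finset.sum_preimage (fun k : ℕ => ((k : ℝ), e - k)) _ hinj.injOn]
  · simp [HahnSeries.ofPowerSeries_apply_coeff]
  · rintro ⟨x, y⟩ hx hn
    obtain ⟨h1, -, h3⟩ := Finset.mem_antidiagonal.1 hx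
    obtain ⟨n, hn'⟩ := exists_natCast_of_coeff_ofPowerSeries_ne_zero h1
    simp only at h3 hn'
    exact absurd ⟨n, Prod.ext hn' (by simp only; linarith)⟩ hn
  · intro k hk
    rw [Finset.mem_coe, Finset.mem_preimage, Finset.mem_antidiagonal]
    refine ⟨?_, right_ne_zero_of_mul hk, by simp⟩
    rw [HahnSeries.mem_support, HahnSeries.ofPowerSeries_apply_coeff]
    exact left_ne_zero_of_mul hk

theorem diffOp_logSum (g : PowerSeries ℂ) (α : ℕ →₀ ℝ) (s : HahnSeries ℝ ℂ) :
    diffOp g (logSum α s) = logSum α (HahnSeries.ofPowerSeries ℝ ℂ g * s) := by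
  ext γ
  change ∑ᶠ k : ℕ, PowerSeries.coeff k g * (D^[k] (logSum α s)).coeff γ = _
  simp only [D_iterate_logSum, coeff_logSum, coeff_ofPowerSeries_mul,
    HahnSeries.coeff_single_mul, one_mul, ← mul_assoc, finsum_mul]

/-! ### Harmonic logarithms and augmentation in coordinates -/

theorem harmonicLog_eq_logSum (a : ℝ) (α : ℕ →₀ ℝ) :
    harmonicLog a α = logSum α (HahnSeries.single (-a) (romanFactorial a : ℂ)) := by
  ext g
  rw [coeff_logSum]
  change (if xExp g = a then romanFactorial a * unitCoeff a α (logExp g) else 0) = _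
  split_ifs with h
  · rw [h, HahnSeries.coeff_single_same]
  · rw [HahnSeries.coeff_single_of_ne (by simpa using h), zero_mul]

theorem logSum_smul (α : ℕ →₀ ℝ) (c : ℂ) (s : HahnSeries ℝ ℂ) :
    logSum α (c • s) = c • logSum α s := by
  ext g
  simp only [coeff_logSum, HahnSeries.coeff_smul, smul_eq_mul, mul_assoc]

theorem augmentation_logSum (α : ℕ →₀ ℝ) (s : HahnSeries ℝ ℂ) :
    augmentation α (logSum α s) = s.coeff 0 := by
  have h : unitCoeff 0 α α = 1 := by
    rw [unitCoeff_eq (k := 0) (by simp)]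
    simp [logMonomial, stirlingNeg]
  rw [augmentation, coeff_logSum, xExp_expo, logExp_expo, h, neg_zero, mul_one]

/-! ### Roman factorials -/

theorem romanFactorial_natCast (n : ℕ) : romanFactorial n = n.factorial := by
  rw [romanFactorial, if_neg, Real.Gamma_nat_eq_factorial]
  rintro ⟨m, hm⟩
  have h1 : (0 : ℝ) ≤ n := Nat.cast_nonneg n
  have h2 : (0 : ℝ) ≤ m := Nat.cast_nonneg m
  linarith

theorem romanFactorial_zero : romanFactorial 0 = 1 := by
  simpa using romanFactorial_natCast 0

theorem romanFactorial_neg_succ (n : ℕ) :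
    romanFactorial (-(n + 1)) = (-1) ^ n / n.factorial := by
  have h : ⌊-(-((n : ℝ) + 1)) - 1⌋₊ = n := by simp
  rw [romanFactorial, if_pos ⟨n, rfl⟩, h]

/-- At `a = 0` this rests on the conventions `⌊0⌉ = 1` and `⌊-1⌉! = 1`. -/
theorem romanFactorial_intCast (a : ℤ) :
    romanFactorial a = romanNumber a * romanFactorial (a - 1) := by
  rcases a with n | n
  · cases n with
    | zero =>
      have := romanFactorial_neg_succ 0
      simp at this
      simp [romanFactorial_zero, romanNumber, this]
    | succ n =>
      have h := romanFactorial_natCast (n + 1)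
      have h' := romanFactorial_natCast n
      have hn : ((n : ℝ) + 1) ≠ 0 := Nat.cast_add_one_ne_zero n
      simp only [Int.ofNat_eq_natCast, Int.cast_natCast, h]
      push_cast
      rw [add_sub_cancel_right, h', romanNumber, if_neg hn, Nat.factorial_succ]
      push_cast
      ring
  · have h := romanFactorial_neg_succ n
    have h' := romanFactorial_neg_succ (n + 1)
    have hn : ((n : ℝ) + 1) ≠ 0 := Nat.cast_add_one_ne_zero n
    have hf : (n.factorial : ℝ) ≠ 0 := Nat.cast_ne_zero.2 n.factorial_ne_zero
    have hc : ((Int.negSucc n : ℤ) : ℝ) = -((n : ℝ) + 1) := by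
      rw [Int.cast_negSucc]; push_cast; ring
    rw [hc, h, romanNumber, if_neg (neg_ne_zero.2 hn),
      show -((n : ℝ) + 1) - 1 = -(((n + 1 : ℕ) : ℝ) + 1) by push_cast; ring, h',
      Nat.factorial_succ]
    push_cast
    field_simp
    ring

/-! ### The residual harmonic logarithm -/

theorem coeff_logMonomial_ne_zero {α β : ℕ →₀ ℝ} {a : ℝ}
    (h : (logMonomial α).coeff (expo a β) ≠ 0) : a = 0 ∧ β = α :=
  expo_inj.1 (by simpa using HahnSeries.support_single_subset h)

theorem xExp_mul_coeff_logMonomial (α : ℕ →₀ ℝ) (g : Expo) :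
    (xExp g : ℂ) * (logMonomial α).coeff g = 0 := by
  by_contra h
  exact left_ne_zero_of_mul h (by
    rw [(coeff_logMonomial_ne_zero (a := xExp g) (β := logExp g) (right_ne_zero_of_mul h)).1,
      Complex.ofReal_zero])

theorem euler_log : euler (logMonomial (Finsupp.single 0 1)) = logMonomial 0 := by
  have ho : ones 0 = Finsupp.single 0 1 := by simp [ones]
  ext g
  change eulerCoeff _ g = _
  rw [eulerCoeff, xExp_mul_coeff_logMonomial, zero_add, finsum_eq_single _ 0]
  · by_cases hg : g = expo 0 0
    · simp [hg, ho, logMonomial]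
    · rw [logMonomial, logMonomial, HahnSeries.coeff_single_of_ne hg,
        HahnSeries.coeff_single_of_ne, mul_zero]
      intro h
      obtain ⟨h2, h3⟩ := expo_inj.1 h
      rw [ho, add_eq_right] at h3
      exact hg (by rw [← expo_eta g, h2, h3])
  · intro j hj
    by_contra h
    have h2 := DFunLike.congr_fun (coeff_logMonomial_ne_zero (right_ne_zero_of_mul h)).2 j
    rw [Finsupp.add_apply, ones_apply, if_pos le_rfl, Finsupp.single_eq_of_ne hj] at h2
    exact left_ne_zero_of_mul h (by exact_mod_cast h2)

theorem euler_one : euler (logMonomial 0) = 0 := by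
  ext g
  change eulerCoeff _ g = 0
  rw [eulerCoeff, xExp_mul_coeff_logMonomial, zero_add, finsum_eq_zero_of_forall_eq_zero]
  intro j
  by_contra h
  have h2 := DFunLike.congr_fun (coeff_logMonomial_ne_zero (right_ne_zero_of_mul h)).2 j
  rw [Finsupp.add_apply, ones_apply, if_pos le_rfl, Finsupp.zero_apply] at h2
  exact left_ne_zero_of_mul h (by exact_mod_cast h2)

theorem euler_zero : euler 0 = 0 := by
  ext g
  change eulerCoeff 0 g = 0
  simp [eulerCoeff]

theorem unitCoeff_neg_one (β : ℕ →₀ ℝ) :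
    unitCoeff (-1) (Finsupp.single 0 1) β = (logMonomial 0).coeff (expo 0 β) := by
  -- `Complex.Gamma 0 = 0` and division by zero give the true value `0` of `1 / Γ` at its pole.
  have h0 : stirlingNeg (-1) 0 = 0 := by simp [stirlingNeg]
  have h1 : stirlingNeg (-1) 1 = 1 := by
    have h := stirlingNeg_sub_one_succ 0 0
    rw [zero_sub, Complex.ofReal_zero, zero_mul, zero_add] at h
    rw [h]
    simp [stirlingNeg]
  rw [unitCoeff, finsum_eq_single _ 1]
  · rw [h1, one_mul, Function.iterate_one, euler_log]
  · intro k hk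
    rcases k with _ | _ | k
    · rw [h0, zero_mul]
    · exact absurd rfl hk
    -- Two applications of `x d/dx` annihilate `log x`.
    · rw [Function.iterate_add_apply _ (k + 1) 1, Function.iterate_add_apply _ k 1,
        Function.iterate_one, euler_log, euler_one, Function.iterate_fixed euler_zero,
        HahnSeries.coeff_zero, mul_zero]

theorem harmonicLog_neg_one : harmonicLog (-1) (Finsupp.single 0 1) = xPow (-1) := by
  have hr : romanFactorial (-1) = 1 := by simpa using romanFactorial_neg_succ 0
  ext g
  change (if xExp g = -1 then (romanFactorial (-1) : ℂ) *
    unitCoeff (-1) (Finsupp.single 0 1) (logExp g) else 0) = _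
  rw [hr, Complex.ofReal_one, one_mul, unitCoeff_neg_one, ← expo_eta g]
  simp only [xExp_expo, logExp_expo, xPow, logMonomial, HahnSeries.coeff_single, expo_inj,
    true_and]
  split_ifs <;> simp_all

end IterLog

namespace IterLog

open HahnSeries (single ofPowerSeries)

/-! ### Uniqueness of the residual coordinates -/

theorem coeff_single_mul_ofPowerSeries_mul (a : ℝ) (w : PowerSeries ℂ) (s : HahnSeries ℝ ℂ) :
    (single (-a) (1 : ℂ) * (ofPowerSeries ℝ ℂ w * s)).coeff 0 =
      (ofPowerSeries ℝ ℂ w * s).coeff a := by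
  rw [HahnSeries.coeff_single_mul, one_mul, sub_neg_eq_add, zero_add]

theorem coeff_ofPowerSeries_mul_order (w : PowerSeries ℂ) (s : HahnSeries ℝ ℂ) :
    (ofPowerSeries ℝ ℂ w * s).coeff s.order =
      PowerSeries.constantCoeff w * s.coeff s.order := by
  rw [coeff_ofPowerSeries_mul, finsum_eq_single _ 0]
  · simp
  · intro k hk
    rw [HahnSeries.coeff_eq_zero_of_lt_order, mul_zero]
    have : (0 : ℝ) < k := Nat.cast_pos.2 (Nat.pos_of_ne_zero hk)
    linarith

/-- Multiplication by `w a` only rescales the lowest coefficient by the nonzero constant term. If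
the difference were nonzero, the condition at its order `a` would therefore fail. -/
theorem eq_ofPowerSeries_of_coeff_eq {E : Set ℝ} (hE : ∀ n : ℕ, (n : ℝ) ∈ E)
    {s : HahnSeries ℝ ℂ} (hs : s.support ⊆ E) (h : PowerSeries ℂ) (w : ℝ → PowerSeries ℂ)
    (hw : ∀ a ∈ E, PowerSeries.constantCoeff (w a) ≠ 0)
    (hc : ∀ a ∈ E, (ofPowerSeries ℝ ℂ (w a) * s).coeff a =
      (ofPowerSeries ℝ ℂ (w a * h)).coeff a) : s = ofPowerSeries ℝ ℂ h := by
  by_contra hne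
  have hd : s - ofPowerSeries ℝ ℂ h ≠ 0 := sub_ne_zero.2 hne
  generalize hdef : s - ofPowerSeries ℝ ℂ h = d at hd
  have h0 : d.coeff d.order ≠ 0 := HahnSeries.coeff_order_eq_zero.not.2 hd
  -- The conditions are available only for exponents in `E`; both series are supported there.
  have hm : d.order ∈ E := by
    by_contra hm
    refine h0 ?_
    rw [← hdef, HahnSeries.coeff_sub, hdef]
    have h1 : s.coeff d.order = 0 := by
      by_contra h1
      exact hm (hs h1)
    have h2 : (ofPowerSeries ℝ ℂ h).coeff d.order = 0 := by
      by_contra h2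
      obtain ⟨n, hn⟩ := exists_natCast_of_coeff_ofPowerSeries_ne_zero h2
      exact hm (hn ▸ hE n)
    rw [h1, h2, sub_zero]
  refine mul_ne_zero (hw _ hm) h0 ?_
  rw [← coeff_ofPowerSeries_mul_order, ← hdef, mul_sub, HahnSeries.coeff_sub, hdef, hc _ hm,
    map_mul, sub_self]

section Transfer

variable {f : PowerSeries ℂ} (h0 : PowerSeries.constantCoeff f = 0)
  (h1 : PowerSeries.coeff 1 f ≠ 0)

include h0 h1

/-- If `a` is not a natural number, the coefficient vanishes for any `w`, so real powers of `u`
never have to be expanded. -/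
theorem coeff_ofPowerSeries_residue {a : ℝ} {w : PowerSeries ℂ}
    (hw : ∀ m : ℕ, a = m → w = (divD f)⁻¹ ^ m) :
    (ofPowerSeries ℝ ℂ (w * (PowerSeries.derivative ℂ f * (divD f)⁻¹))).coeff a =
      if a = 0 then 1 else 0 := by
  by_cases ha : ∃ m : ℕ, a = m
  · obtain ⟨m, rfl⟩ := ha
    rw [HahnSeries.ofPowerSeries_apply_coeff, hw m rfl]
    by_cases hm : m = 0
    · subst hm
      rw [pow_zero, one_mul, PowerSeries.coeff_zero_eq_constantCoeff_apply,
        constantCoeff_derivative_mul_inv h1, Nat.cast_zero, if_pos rfl]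
    · rw [coeff_inv_divD_pow_mul h0 h1 hm, if_neg (Nat.cast_ne_zero.2 hm)]
  · rw [if_neg fun h => ha ⟨0, by simpa using h⟩]
    by_contra h
    obtain ⟨n, hn⟩ := exists_natCast_of_coeff_ofPowerSeries_ne_zero h
    exact ha ⟨n, hn.symm⟩

theorem eq_residue_of_coeff {E : Set ℝ} (hE : ∀ n : ℕ, (n : ℝ) ∈ E)
    {s : HahnSeries ℝ ℂ} (hs : s.support ⊆ E) (w : ℝ → PowerSeries ℂ)
    (hw : ∀ a ∈ E, PowerSeries.constantCoeff (w a) ≠ 0)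
    (hp : ∀ m : ℕ, w m = (divD f)⁻¹ ^ m)
    (hc : ∀ a ∈ E, (single (-a) (1 : ℂ) * (ofPowerSeries ℝ ℂ (w a) * s)).coeff 0 =
      if a = 0 then 1 else 0) :
    s = ofPowerSeries ℝ ℂ (PowerSeries.derivative ℂ f * (divD f)⁻¹) := by
  refine eq_ofPowerSeries_of_coeff_eq hE hs _ w hw fun a ha => ?_
  rw [coeff_ofPowerSeries_residue h0 h1 fun m hm => hm ▸ hp m,
    ← coeff_single_mul_ofPowerSeries_mul, hc a ha]

end Transfer

theorem mul_smul_hahnSeries (c : ℂ) (x y : HahnSeries ℝ ℂ) : x * c • y = c • (x * y) := by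
  rw [← HahnSeries.C_mul_eq_smul, ← HahnSeries.C_mul_eq_smul, mul_left_comm]

/-- Applied with `g = f'`, `w = u ^ (-a)` and `h = u⁻¹`, so that the right side is the solved
recursion with `s_0 = f' u⁻¹`. -/
theorem diffOp_mul_harmonicLog (g h w : PowerSeries ℂ) (a : ℝ) (α : ℕ →₀ ℝ) :
    diffOp (g * (w * h)) (harmonicLog a α) =
      logSum α ((romanFactorial a : ℂ) •
        (single (-a) 1 * (ofPowerSeries ℝ ℂ w * ofPowerSeries ℝ ℂ (g * h)))) := by
  have h1 : single (-a) (romanFactorial a : ℂ) =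
      (romanFactorial a : ℂ) • (single (-a) 1 : HahnSeries ℝ ℂ) := by
    rw [← HahnSeries.C_mul_eq_smul, HahnSeries.C_apply, HahnSeries.single_mul_single, zero_add,
      mul_one]
  rw [harmonicLog_eq_logSum, diffOp_logSum, h1, mul_smul_hahnSeries]
  simp only [map_mul]
  ring_nf

/-! ### The discrete case -/

theorem mul_intPow_inv {u : PowerSeries ℂ} (hu : PowerSeries.constantCoeff u ≠ 0) (a : ℤ) :
    u * intPow u⁻¹ a = intPow u⁻¹ (a - 1) := by
  have hi := PowerSeries.mul_inv_cancel u hu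
  have hii : u⁻¹⁻¹ = u :=
    (PowerSeries.inv_eq_iff_mul_eq_one (by simpa using hu)).2 hi
  rcases a with (_ | n) | n
  · change u * u⁻¹ ^ 0 = u⁻¹⁻¹ ^ (0 + 1)
    rw [hii]; ring
  · have h : Int.ofNat (n + 1) - 1 = Int.ofNat n := by simp
    rw [h]
    change u * u⁻¹ ^ (n + 1) = u⁻¹ ^ n
    linear_combination u⁻¹ ^ n * hi
  · have h : Int.negSucc n - 1 = Int.negSucc (n + 1) := by
      simp [Int.negSucc_eq]; ring
    rw [h]
    change u * u⁻¹⁻¹ ^ (n + 1) = u⁻¹⁻¹ ^ (n + 1 + 1)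
    rw [hii]; ring

theorem intPow_add_one {u : PowerSeries ℂ} (hu : PowerSeries.constantCoeff u ≠ 0) (a : ℤ) :
    intPow u⁻¹ (a + 1) = intPow u⁻¹ a * u⁻¹ := by
  have h := mul_intPow_inv hu (a + 1)
  rw [add_sub_cancel_right] at h
  linear_combination u⁻¹ * h - intPow u⁻¹ (a + 1) * PowerSeries.mul_inv_cancel u hu

theorem constantCoeff_intPow {u : PowerSeries ℂ} (hu : PowerSeries.constantCoeff u ≠ 0) (a : ℤ) :
    PowerSeries.constantCoeff (intPow u a) ≠ 0 := by
  rcases a with n | n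
  · change PowerSeries.constantCoeff (u ^ n) ≠ 0
    rw [map_pow]
    exact pow_ne_zero _ hu
  · change PowerSeries.constantCoeff (u⁻¹ ^ (n + 1)) ≠ 0
    rw [map_pow, PowerSeries.constantCoeff_inv]
    exact pow_ne_zero _ (inv_ne_zero hu)

theorem romanNumber_ne_zero (a : ℝ) : romanNumber a ≠ 0 := by
  unfold romanNumber
  split_ifs with h
  · exact one_ne_zero
  · exact h

/-- Solution of the recursion `f(D) s_a = ⌊a⌉ s_(a-1)`. -/
theorem coords_eq_of_lowering {f : PowerSeries ℂ} (h0 : PowerSeries.constantCoeff f = 0)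
    (h1 : PowerSeries.coeff 1 f ≠ 0) {s : ℤ → HahnSeries ℝ ℂ}
    (hs : ∀ a : ℤ, ofPowerSeries ℝ ℂ f * s a = (romanNumber a : ℂ) • s (a - 1)) (a : ℤ) :
    s a = (romanFactorial a : ℂ) •
      (single (-(a : ℝ)) 1 * (ofPowerSeries ℝ ℂ (intPow (divD f)⁻¹ a) * s 0)) := by
  have hu : PowerSeries.constantCoeff (divD f) ≠ 0 := by rwa [constantCoeff_divD]
  have hf : ofPowerSeries ℝ ℂ f ≠ 0 := by
    intro h
    refine h1 ?_
    rw [← HahnSeries.ofPowerSeries_apply_coeff (Γ := ℝ), h, HahnSeries.coeff_zero]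
  have hstep : ∀ a : ℤ, ofPowerSeries ℝ ℂ f *
      (single (-(a : ℝ)) 1 * (ofPowerSeries ℝ ℂ (intPow (divD f)⁻¹ a) * s 0)) =
      single (-((a - 1 : ℤ) : ℝ)) 1 *
        (ofPowerSeries ℝ ℂ (intPow (divD f)⁻¹ (a - 1)) * s 0) := by
    intro a
    have h2 : single (-((a - 1 : ℤ) : ℝ)) (1 : ℂ) = single 1 1 * single (-(a : ℝ)) 1 := by
      rw [HahnSeries.single_mul_single, one_mul]; push_cast; ring_nf
    rw [h2, ← mul_intPow_inv hu, map_mul]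
    conv_lhs => enter [1]; rw [eq_X_mul_divD h0, map_mul, HahnSeries.ofPowerSeries_X]
    ring
  have hr : ∀ a : ℤ, (romanFactorial a : ℂ) =
      (romanNumber a : ℂ) * (romanFactorial ((a - 1 : ℤ) : ℝ) : ℂ) := by
    intro a
    rw [romanFactorial_intCast]; push_cast; rfl
  induction a using Int.induction_on with
  | zero =>
    have h2 : intPow (divD f)⁻¹ 0 = 1 := pow_zero _
    have h3 : (single (0 : ℝ) (1 : ℂ)) = 1 := rfl
    rw [h2, Int.cast_zero, neg_zero, h3, romanFactorial_zero]
    simp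
  | succ n ih =>
    -- Upwards, the recursion gives only `f s_(n+1)`; the Hahn series form a domain, so `f` cancels.
    refine mul_left_cancel₀ hf ?_
    rw [hs, mul_smul_hahnSeries, hstep, hr, mul_smul, add_sub_cancel_right, ih]
  | pred n ih =>
    -- Downwards, it gives `⌊-n⌉ s_(-n-1)`, and Roman numbers never vanish, even at `n = 0`.
    have h2 := hs (-(n : ℤ))
    have h3 : (romanNumber ((-n : ℤ) : ℝ) : ℂ) ≠ 0 := by exact_mod_cast romanNumber_ne_zero _
    rw [ih, mul_smul_hahnSeries, hstep, hr, mul_smul] at h2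
    exact (smul_right_injective _ h3 h2).symm

theorem discrete_transfer {S : Set (ℕ →₀ ℝ)} (hS : Finsupp.single 0 1 ∈ S)
    {f : PowerSeries ℂ} (h0 : PowerSeries.constantCoeff f = 0)
    (h1 : PowerSeries.coeff 1 f ≠ 0) {p : ℤ → (ℕ →₀ ℝ) → IterLogAlg}
    (hp : IsDiscreteAssociated S f p) (a : ℤ) {α : ℕ →₀ ℝ} (hα : α ∈ S) :
    p a α = diffOp (PowerSeries.derivative ℂ f * intPow (divD f)⁻¹ (a + 1))
      (harmonicLog a α) := by
  have hu : PowerSeries.constantCoeff (divD f) ≠ 0 := by rwa [constantCoeff_divD]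
  have hne : (Finsupp.single 0 1 : ℕ →₀ ℝ) ≠ 0 := by simp
  choose s hsE _ hs using hp.graded
  have hlow : ∀ a : ℤ, ofPowerSeries ℝ ℂ f * s a = (romanNumber a : ℂ) • s (a - 1) := by
    intro a
    -- The order `(1)` alone yields the recursion; independence of `α` then carries the result to
    -- all orders.
    refine logSum_injective hne ?_
    rw [← diffOp_logSum, ← hs a _ hS, hp.lowering _ hS hne, logSum_smul, ← hs _ _ hS]
  have hsol := coords_eq_of_lowering h0 h1 hlow
  have hs0 : s 0 = ofPowerSeries ℝ ℂ (PowerSeries.derivative ℂ f * (divD f)⁻¹) := by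
    -- The floor merely extends the weight to real arguments; only integers are tested.
    refine eq_residue_of_coeff h0 h1 (E := Set.range ((↑) : ℤ → ℝ))
      (fun n => ⟨n, Int.cast_natCast n⟩) ?_ (fun a => intPow (divD f)⁻¹ ⌊a⌋)
      (fun a _ => constantCoeff_intPow (by simpa using hu) _) ?_ ?_
    · intro e he
      obtain ⟨m, hm⟩ := hsE 0 e he
      exact ⟨-m, by rw [Int.cast_neg, hm, neg_neg]⟩
    · intro m
      rw [Int.floor_natCast]
      rfl
    · rintro _ ⟨a, rfl⟩
      have h2 : (s a).coeff 0 = if a = 0 then 1 else 0 := by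
        rw [← augmentation_logSum (Finsupp.single 0 1), ← hs a _ hS]
        split_ifs with ha
        · rw [ha, hp.augmentation_zero _ hS]
        · exact hp.augmentation_ne _ hS a ha
      have hr : (romanFactorial a : ℂ) ≠ 0 := by exact_mod_cast romanFactorial_ne_zero a
      rw [hsol a, HahnSeries.coeff_smul, smul_eq_mul] at h2
      rw [Int.floor_intCast]
      by_cases ha : a = 0
      · subst ha
        simpa [romanFactorial_zero] using h2
      · rw [if_neg ha] at h2
        rw [if_neg (Int.cast_ne_zero.2 ha)]
        exact (mul_eq_zero.1 h2).resolve_left hr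
  rw [intPow_add_one hu, diffOp_mul_harmonicLog, ← hs0, ← hsol, hs a α hα]

/-! ### The continuous case -/

theorem exp_branchLog {c : ℂ} (hc : c ≠ 0) (n : ℤ) : Complex.exp (branchLog c n) = c := by
  rw [branchLog, Complex.exp_add, Complex.exp_log hc,
    show 2 * (Real.pi : ℂ) * Complex.I * n = n * (2 * Real.pi * Complex.I) by ring,
    Complex.exp_int_mul_two_pi_mul_I, mul_one]

theorem continuous_transfer {S : Set (ℕ →₀ ℝ)} (hS : Finsupp.single 0 1 ∈ S)
    {f : PowerSeries ℂ} (h0 : PowerSeries.constantCoeff f = 0)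
    (h1 : PowerSeries.coeff 1 f ≠ 0) {n : ℤ} {p : ℝ → (ℕ →₀ ℝ) → IterLogAlg}
    (hp : IsAssociated S f n p) (a : ℝ) {α : ℕ →₀ ℝ} (hα : α ∈ S) :
    p a α = diffOp (PowerSeries.derivative ℂ f * ratioPow f n (a + 1)) (harmonicLog a α) := by
  have hL : Complex.exp (branchLog (PowerSeries.coeff 1 f) n) =
      PowerSeries.constantCoeff (divD f) := by rw [exp_branchLog h1, constantCoeff_divD]
  have hne : (Finsupp.single 0 1 : ℕ →₀ ℝ) ≠ 0 := by simp
  choose s _ _ hs using hp.graded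
  have hlow : ∀ a b : ℝ, artinianPow f n b * s a =
      ((romanFactorial a / romanFactorial (a - b) : ℝ) : ℂ) • s (a - b) := by
    intro a b
    have h := hp.lowering _ hS hne a b
    rw [artinianOp, hs a _ hS, coords_logSum hne, hs (a - b) _ hS, ← logSum_smul] at h
    exact logSum_injective hne h
  have hr : ∀ a : ℝ, (romanFactorial a : ℂ) ≠ 0 := fun a => by
    exact_mod_cast romanFactorial_ne_zero a
  have hsol : ∀ a : ℝ, s a = (romanFactorial a : ℂ) • (single (-a) 1 *
      (ofPowerSeries ℝ ℂ
        (branchPow (divD f) (branchLog (PowerSeries.coeff 1 f) n) (-a)) * s 0)) := by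
    intro a
    -- Lowering `s_0` by `-a` reaches `s_a` in one step, so no induction is needed.
    have h := hlow 0 (-a)
    rw [zero_sub, neg_neg, romanFactorial_zero, artinianPow, mul_assoc] at h
    rw [h, smul_smul]
    push_cast
    rw [mul_one_div_cancel (hr a), one_smul]
  have hs0 : s 0 = ofPowerSeries ℝ ℂ (PowerSeries.derivative ℂ f * (divD f)⁻¹) := by
    refine eq_residue_of_coeff h0 h1 (E := Set.univ) (fun _ => trivial) (Set.subset_univ _)
      (fun a => branchPow (divD f) (branchLog (PowerSeries.coeff 1 f) n) (-a))
      (fun a _ => constantCoeff_branchPow hL _) (branchPow_neg_natCast hL) ?_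
    intro a _
    have h2 : (s a).coeff 0 = if a = 0 then 1 else 0 := by
      rw [← augmentation_logSum (Finsupp.single 0 1), ← hs a _ hS]
      split_ifs with ha
      · rw [ha, hp.augmentation_zero _ hS]
      · exact hp.augmentation_ne _ hS a ha
    rw [hsol a, HahnSeries.coeff_smul, smul_eq_mul] at h2
    by_cases ha : a = 0
    · subst ha
      simpa [romanFactorial_zero] using h2
    · rw [if_neg ha] at h2 ⊢
      exact (mul_eq_zero.1 h2).resolve_left (hr a)
  rw [ratioPow, ← branchPow_neg_mul_inv hL, diffOp_mul_harmonicLog, ← hs0, ← hsol, hs a α hα]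

end IterLog

/-! ### The Transfer Formula and the residual series -/

theorem mainTheorem6 (S : Set (ℕ →₀ ℝ)) (hS : Finsupp.single 0 1 ∈ S)
    (f : PowerSeries ℂ) (hf : f.order = 1) :
    (∀ p : ℤ → (ℕ →₀ ℝ) → IterLog.IterLogAlg, IterLog.IsDiscreteAssociated S f p →
      (∀ a : ℤ, ∀ α ∈ S, p a α =
        IterLog.diffOp
          (PowerSeries.derivative ℂ f * IterLog.intPow (IterLog.divD f)⁻¹ (a + 1))
          (IterLog.harmonicLog a α)) ∧
      p (-1) (Finsupp.single 0 1) =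
        IterLog.diffOp (PowerSeries.derivative ℂ f) (IterLog.xPow (-1))) ∧
    (∀ (n : ℤ) (p : ℝ → (ℕ →₀ ℝ) → IterLog.IterLogAlg), IterLog.IsAssociated S f n p →
      (∀ a : ℝ, ∀ α ∈ S, p a α =
        IterLog.diffOp
          (PowerSeries.derivative ℂ f * IterLog.ratioPow f n (a + 1))
          (IterLog.harmonicLog a α)) ∧
      p (-1) (Finsupp.single 0 1) =
        IterLog.diffOp (PowerSeries.derivative ℂ f) (IterLog.xPow (-1))) := by

  have h0 : PowerSeries.constantCoeff f = 0 := by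
    rw [← PowerSeries.coeff_zero_eq_constantCoeff_apply]
    exact PowerSeries.coeff_of_lt_order 0 (by rw [hf]; exact_mod_cast zero_lt_one)
  have h1 : PowerSeries.coeff 1 f ≠ 0 := by
    have h : f ≠ 0 := by
      rintro rfl
      simp at hf
    have := PowerSeries.coeff_order h
    rwa [hf] at this
  refine ⟨fun p hp => ?_, fun n p hp => ?_⟩
  · have h := fun a α (hα : α ∈ S) => IterLog.discrete_transfer hS h0 h1 hp a hα
    refine ⟨h, ?_⟩
    -- For `a = -1` the power of `D / f(D)` is trivial, and `λ_(-1)^(1) = x⁻¹`.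
    have h2 : IterLog.intPow (IterLog.divD f)⁻¹ (-1 + 1) = 1 := pow_zero _
    have h3 := h (-1) _ hS
    rw [h2, mul_one] at h3
    rw [h3, Int.cast_neg, Int.cast_one, IterLog.harmonicLog_neg_one]
  · have h := fun a α (hα : α ∈ S) => IterLog.continuous_transfer hS h0 h1 hp a hα
    refine ⟨h, ?_⟩
    have hc : Complex.exp (-IterLog.branchLog (PowerSeries.coeff 1 f) n) =
        PowerSeries.constantCoeff (IterLog.divD f)⁻¹ := by
      rw [Complex.exp_neg, IterLog.exp_branchLog h1, PowerSeries.constantCoeff_inv,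
        IterLog.constantCoeff_divD]
    have h3 := h (-1) _ hS
    rw [neg_add_cancel, IterLog.ratioPow, IterLog.branchPow_zero hc, mul_one] at h3
    rw [h3, IterLog.harmonicLog_neg_one]
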